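/- Let $n\ge 1$ and let $\mathrm{Sym}(n)$ be the space of real symmetric $n\times n$ matrices with inner product $a\cdot b=\operatorname{trace}(ab)$. Let $w:\mathbb R^n\to\mathbb R$ be smooth on $\mathbb R^n\setminus\{0\}$ and homogeneous of order 2, i.e. $w(tx)=t^2w(x)$ for all $t>0$ and $x\in\mathbb R^n$. Suppose that $w$ satisfies property (H): 1. the Hessian map $H:S^{n-1}\to \mathrm{Sym}(n)$, $H(x)=D^2w(x)$, is a smooth embedding; 2. there is a constant $M\ge 1$ such that for any two distinct points $a\ne b$ of $H(S^{n-1})$, if $\mu_1\ge\dots\ge\mu_n$ are the eigenvalues of $a-b$, then $1/M<-\mu_1/\mu_n<M$. Then there is a smooth function $F:\mathrm{Sym}(n)\to\mathbb R$ that is uniformly elliptic, i.e. there is a constant $\Lambda\ge1$ with $$\Lambda^{-1}|\xi|^2\le\sum_{i,j}F_{u_{ij}}(a)\,\xi_i\xi_j\le\Lambda|\xi|^2\qquad\text{for all } a\in \mathrm{Sym}(n),\ \xi\in\mathbb R^n$$ (the middle term being the derivative of $F$ at $a$ in the direction $\xi\xi^{T}$), such that $w$ is a viscosity solution of $F(D^2u)=0$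 in all of $\mathbb R^n$: $w$ is continuous, and for every $x\in\mathbb R^n$ and every function $\varphi$ that is $C^2$ near $x$, one has $F(D^2\varphi(x))\ge0$ if $w-\varphi$ has a local maximum at $x$, and $F(D^2\varphi(x))\le0$ if $w-\varphi$ has a local minimum at $x$. -/

import Mathlib

open Set Topology Metric
open scoped Manifold ContDiff

/-- The space of real symmetric `n × n` matrices (identified with the quadratic forms on `ℝⁿ`),
with the norm `‖a‖² = trace (a * a)`. -/
def SymMat (n : ℕ) : Type :=
  selfAdjoint.submodule ℝ (Matrix (Fin n) (Fin n) ℝ)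

section
attribute [local instance] Matrix.frobeniusNormedAddCommGroup Matrix.frobeniusNormedSpace

noncomputable instance (n : ℕ) : NormedAddCommGroup (SymMat n) :=
  inferInstanceAs (NormedAddCommGroup (selfAdjoint.submodule ℝ (Matrix (Fin n) (Fin n) ℝ)))

noncomputable instance (n : ℕ) : NormedSpace ℝ (SymMat n) :=
  inferInstanceAs (NormedSpace ℝ (selfAdjoint.submodule ℝ (Matrix (Fin n) (Fin n) ℝ)))

end

/-- The underlying matrix. -/
instance (n : ℕ) : CoeOut (SymMat n) (Matrix (Fin n) (Fin n) ℝ) :=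
  ⟨Subtype.val⟩

theorem SymMat.isHermitian {n : ℕ} (a : SymMat n) : (a : Matrix (Fin n) (Fin n) ℝ).IsHermitian :=
  a.2

/-- The largest eigenvalue `μ₁` of a symmetric matrix. -/
noncomputable def SymMat.maxEigenvalue {n : ℕ} (a : SymMat n) : ℝ :=
  ⨆ i, a.isHermitian.eigenvalues i

/-- The smallest eigenvalue `μₙ` of a symmetric matrix. -/
noncomputable def SymMat.minEigenvalue {n : ℕ} (a : SymMat n) : ℝ :=
  ⨅ i, a.isHermitian.eigenvalues i

/-- The rank one symmetric matrix `ξ ξᵀ`, with entries `ξᵢ ξⱼ`. -/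
def SymMat.rankOne {n : ℕ} (ξ : EuclideanSpace ℝ (Fin n)) : SymMat n :=
  ⟨Matrix.of fun i j => ξ i * ξ j, by
    change star _ = _
    ext i j
    simp [Matrix.star_apply, mul_comm]⟩

/-- The matrix of second partial derivatives `∂²u / ∂xᵢ ∂xⱼ` at `x`. -/
noncomputable def hessianMatrix {n : ℕ} (u : EuclideanSpace ℝ (Fin n) → ℝ)
    (x : EuclideanSpace ℝ (Fin n)) : Matrix (Fin n) (Fin n) ℝ :=
  Matrix.of fun i j =>
    fderiv ℝ (fderiv ℝ u) x (EuclideanSpace.single i 1) (EuclideanSpace.single j 1)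

/-- The Hessian `D²u(x)` as a symmetric matrix. It is the symmetric part of the matrix of second
partial derivatives, hence that matrix itself wherever `u` is `C²`, see `coe_hessian`. -/
noncomputable def hessian {n : ℕ} (u : EuclideanSpace ℝ (Fin n) → ℝ)
    (x : EuclideanSpace ℝ (Fin n)) : SymMat n :=
  selfAdjointPart ℝ (hessianMatrix u x)

theorem coe_hessian {n : ℕ} {u : EuclideanSpace ℝ (Fin n) → ℝ} {x : EuclideanSpace ℝ (Fin n)}
    (hu : ContDiffAt ℝ 2 u x) :
    (hessian u x : Matrix (Fin n) (Fin n) ℝ) = hessianMatrix u x := by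
  have h : IsSelfAdjoint (hessianMatrix u x) := by
    change star _ = _
    ext i j
    have hs : IsSymmSndFDerivAt ℝ u x := hu.isSymmSndFDerivAt (by simp)
    simpa [Matrix.star_apply, hessianMatrix] using
      hs.eq (EuclideanSpace.single j 1) (EuclideanSpace.single i 1)
  exact h.coe_selfAdjointPart_apply ℝ

/-- Uniform ellipticity of `F(D²u) = 0`: `F` is differentiable, and for some `Λ ≥ 1` the quadratic
form `∑ F_{uᵢⱼ} ξᵢ ξⱼ`, which is the derivative of `F` in the direction `ξ ξᵀ`, lies between
`Λ⁻¹ |ξ|²` and `Λ |ξ|²` at every symmetric matrix. -/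
def IsUniformlyElliptic {n : ℕ} (F : SymMat n → ℝ) : Prop :=
  Differentiable ℝ F ∧
    ∃ Λ : ℝ, 1 ≤ Λ ∧ ∀ (a : SymMat n) (ξ : EuclideanSpace ℝ (Fin n)),
      Λ⁻¹ * ‖ξ‖ ^ 2 ≤ fderiv ℝ F a (SymMat.rankOne ξ) ∧
        fderiv ℝ F a (SymMat.rankOne ξ) ≤ Λ * ‖ξ‖ ^ 2

/-- `u` is a viscosity solution of `F(D²u) = 0` in the open set `Ω`: it is continuous, and for every
`x ∈ Ω` and every test function `φ` of class `C²` near `x`, `F(D²φ(x)) ≥ 0` if `u - φ` has a local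
maximum at `x`, and `F(D²φ(x)) ≤ 0` if `u - φ` has a local minimum at `x`. -/
structure IsViscositySolution {n : ℕ} (F : SymMat n → ℝ) (Ω : Set (EuclideanSpace ℝ (Fin n)))
    (u : EuclideanSpace ℝ (Fin n) → ℝ) : Prop where
  continuousOn : ContinuousOn u Ω
  subsolution : ∀ x ∈ Ω, ∀ φ : EuclideanSpace ℝ (Fin n) → ℝ, ContDiffAt ℝ 2 φ x →
    IsLocalMax (fun y => u y - φ y) x → 0 ≤ F (hessian φ x)
  supersolution : ∀ x ∈ Ω, ∀ φ : EuclideanSpace ℝ (Fin n) → ℝ, ContDiffAt ℝ 2 φ x →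
    IsLocalMin (fun y => u y - φ y) x → F (hessian φ x) ≤ 0

/-- The restriction of the Hessian of `w` to the unit sphere. -/
noncomputable def sphereHessian {n : ℕ} (w : EuclideanSpace ℝ (Fin n) → ℝ) :
    sphere (0 : EuclideanSpace ℝ (Fin n)) 1 → SymMat n :=
  fun x => hessian w x

/-- Property (H) for a function on `ℝⁿ`, `n = d + 1`, whose unit sphere has dimension `d`. -/
structure PropertyH {d : ℕ} (w : EuclideanSpace ℝ (Fin (d + 1)) → ℝ) : Prop where
  embedding : Manifold.IsSmoothEmbedding (𝓡 d) 𝓘(ℝ, SymMat (d + 1)) ∞ (sphereHessian w)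
  pinching : ∃ M : ℝ, 1 ≤ M ∧ ∀ a ∈ range (sphereHessian w), ∀ b ∈ range (sphereHessian w), a ≠ b →
    1 / M < -((a - b).maxEigenvalue / (a - b).minEigenvalue) ∧
      -((a - b).maxEigenvalue / (a - b).minEigenvalue) < M

/-! Let `A` be the image of the unit sphere under the Hessian, and put `P a = trace a + K μ₁(a)`
with `K = n M`. The functional `P` is sublinear, and pinching makes `P (a - b) ≥ 0` for all `a, b`
in `A`. It suffices to find a smooth `F` vanishing on `A` with `dF ≤ P + ½‖·‖` everywhere:
evaluating this bound at `± ξξᵀ` is exactly uniform ellipticity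
(`isUniformlyElliptic_of_fderiv_le`).

Construction of `F` (`exists_contDiff_fderiv_apply_le`): `P ≥ 0` persists on tangent vectors of `A`,
so by Hahn–Banach the zero functional on a tangent space extends to some `l ≤ P`. Composing `l` with
`id - r`, where `r` is a local smooth retraction onto `A`, gives a local solution. Local solutions
are glued by a partition of unity, which costs nothing on `A` because all of them vanish there. Away
from `A` the result is replaced by a mollified McShane extension with respect to `P` plus a small
multiple of the norm.

Viscosity: an elliptic `F` is monotone, so it is enough that a test function touching `w` from above
has Hessian at least some element of `A`, and symmetrically from below
(`exists_quad_hessian_le_of_isLocalMax`). Off the origin this is the second order test, as `D²w` is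
homogeneous of degree 0. At the origin, a minimum over the sphere supplies the element of `A`. -/

/-- A positively homogeneous, subadditive real function bounded by a multiple of the norm. -/
structure IsBoundedSublinear {V : Type*} [NormedAddCommGroup V] [NormedSpace ℝ V]
    (P : V → ℝ) : Prop where
  map_smul : ∀ c : ℝ, 0 < c → ∀ v, P (c • v) = c * P v
  map_add_le : ∀ v w, P (v + w) ≤ P v + P w
  bound : ∃ C : ℝ, 0 ≤ C ∧ ∀ v, |P v| ≤ C * ‖v‖

/-! ### Smooth functions with derivative dominated by a sublinear functional. -/

section Sublinear

variable {V : Type*} [NormedAddCommGroup V] [NormedSpace ℝ V] {P Q : V → ℝ}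

theorem IsBoundedSublinear.add_norm (hP : IsBoundedSublinear P) {ε : ℝ} (hε : 0 ≤ ε) :
    IsBoundedSublinear (fun v => P v + ε * ‖v‖) where
  map_smul c hc v := by
    rw [hP.map_smul c hc, norm_smul, Real.norm_of_nonneg hc.le]; ring
  map_add_le v w := by
    have := hP.map_add_le v w
    have := mul_le_mul_of_nonneg_left (norm_add_le v w) hε
    linarith
  bound := by
    obtain ⟨C, hC, h⟩ := hP.bound
    refine ⟨C + ε, by positivity, fun v => ?_⟩
    calc |P v + ε * ‖v‖| ≤ |P v| + |ε * ‖v‖| := abs_add_le _ _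
      _ ≤ C * ‖v‖ + ε * ‖v‖ := by
        rw [abs_of_nonneg (by positivity : 0 ≤ ε * ‖v‖)]
        have := h v
        linarith
      _ = (C + ε) * ‖v‖ := by ring

theorem IsBoundedSublinear.map_zero (hP : IsBoundedSublinear P) : P 0 = 0 := by
  have := hP.map_smul 2 two_pos 0
  rw [smul_zero] at this
  linarith

theorem IsBoundedSublinear.sub_le (hP : IsBoundedSublinear P) (v w : V) :
    P v - P w ≤ P (v - w) := by
  have := hP.map_add_le (v - w) w
  rw [sub_add_cancel] at this
  linarith

theorem exists_abs_sub_le_of_sub_le (hP : IsBoundedSublinear P) {G : V → ℝ}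
    (hG : ∀ x y, G x - G y ≤ P (x - y)) : ∃ C : ℝ, 0 ≤ C ∧ ∀ x y, |G x - G y| ≤ C * ‖x - y‖ := by
  obtain ⟨C, hC, h⟩ := hP.bound
  refine ⟨C, hC, fun x y => abs_le.2 ⟨?_, ?_⟩⟩
  · have h1 := hG y x
    have h2 := (abs_le.1 (h (y - x))).2
    rw [norm_sub_rev y x] at h2
    linarith
  · exact (hG x y).trans (abs_le.1 (h (x - y))).2

theorem uniformContinuous_of_sub_le (hP : IsBoundedSublinear P) {G : V → ℝ}
    (hG : ∀ x y, G x - G y ≤ P (x - y)) : UniformContinuous G := by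
  obtain ⟨C, hC, h⟩ := exists_abs_sub_le_of_sub_le hP hG
  refine (LipschitzWith.of_dist_le_mul (K := ⟨C, hC⟩) fun x y => ?_).uniformContinuous
  rw [Real.dist_eq, dist_eq_norm]
  exact h x y

theorem IsBoundedSublinear.continuous (hP : IsBoundedSublinear P) : Continuous P :=
  (uniformContinuous_of_sub_le hP hP.sub_le).continuous

theorem HasFDerivAt.tendsto_slope_ray {W : Type*} [NormedAddCommGroup W] [NormedSpace ℝ W]
    {f : V → W} {f' : V →L[ℝ] W} {x : V} (h : HasFDerivAt f f' x) (v : V) :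
    Filter.Tendsto (fun t : ℝ => t⁻¹ • (f (x + t • v) - f x)) (𝓝[>] 0) (𝓝 (f' v)) := by
  have h1 : HasDerivAt (fun t : ℝ => f (x + t • v)) (f' v) 0 := h.hasLineDerivAt v
  simpa using h1.tendsto_slope_zero_right

theorem fderiv_apply_le_of_sub_le (hP : IsBoundedSublinear P) {G : V → ℝ}
    (hG : ∀ x y, G x - G y ≤ P (x - y)) (hd : Differentiable ℝ G) (x v : V) :
    fderiv ℝ G x v ≤ P v := by
  refine le_of_tendsto ((hd x).hasFDerivAt.tendsto_slope_ray v) ?_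
  filter_upwards [self_mem_nhdsWithin] with t (ht : 0 < t)
  have h := hG (x + t • v) x
  rw [add_sub_cancel_left, hP.map_smul t ht] at h
  rw [smul_eq_mul, inv_mul_le_iff₀ ht]
  exact h

theorem sub_le_of_fderiv_apply_le {F : V → ℝ} (hF : Differentiable ℝ F) {x y : V} {c : ℝ}
    (h : ∀ z ∈ segment ℝ y x, fderiv ℝ F z (x - y) ≤ c) : F x - F y ≤ c := by
  obtain ⟨z, hz, he⟩ := domain_mvt (f := F) (s := univ) (x := y) (y := x)
    (fun z _ => (hF z).hasFDerivAt.hasFDerivWithinAt) convex_univ (mem_univ _) (mem_univ _)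
  rw [he]
  exact h z hz

/-- McShane's extension with respect to a sublinear function. -/
theorem exists_extension_sub_le (hQ : IsBoundedSublinear Q) {N : Set V} (hN : N.Nonempty)
    {f : V → ℝ} (hf : ∀ x ∈ N, ∀ y ∈ N, f x - f y ≤ Q (x - y)) :
    ∃ G : V → ℝ, (∀ x ∈ N, G x = f x) ∧ ∀ x y, G x - G y ≤ Q (x - y) := by
  obtain ⟨y₀, hy₀⟩ := hN
  have : Nonempty N := ⟨⟨y₀, hy₀⟩⟩
  have bdd : ∀ x, BddBelow (range fun y : N => f y + Q (x - y)) := by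
    intro x
    refine ⟨f y₀ - Q (y₀ - x), ?_⟩
    rintro _ ⟨y, rfl⟩
    have h1 := hf y₀ hy₀ y y.2
    have h2 := hQ.map_add_le (y₀ - x) (x - y)
    rw [sub_add_sub_cancel] at h2
    dsimp only
    linarith
  refine ⟨fun x => ⨅ y : N, f y + Q (x - y), fun x hx => le_antisymm ?_ ?_, fun x y => ?_⟩
  · refine (ciInf_le (bdd x) ⟨x, hx⟩).trans ?_
    simp [hQ.map_zero]
  · refine le_ciInf fun y => ?_
    have := hf x hx y y.2
    linarith
  · rw [sub_le_iff_le_add', ← sub_le_iff_le_add]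
    refine le_ciInf fun z => ?_
    have h1 := ciInf_le (bdd x) z
    have h2 := hQ.map_add_le (x - y) (y - z)
    rw [sub_add_sub_cancel] at h2
    dsimp only at h1 ⊢
    linarith

/-- Smoothing by mollification preserves one-sided bounds on increments. -/
theorem exists_contDiff_sub_le [FiniteDimensional ℝ V] (hQ : IsBoundedSublinear Q) {G : V → ℝ}
    (hG : ∀ x y, G x - G y ≤ Q (x - y)) {η : ℝ} (hη : 0 < η) :
    ∃ g : V → ℝ, ContDiff ℝ ∞ g ∧ (∀ x y, g x - g y ≤ Q (x - y)) ∧ ∀ x, |g x - G x| ≤ η := by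
  borelize V
  let μ : MeasureTheory.Measure V := MeasureTheory.Measure.addHaar
  have hu := uniformContinuous_of_sub_le hQ hG
  obtain ⟨δ, hδ, hGδ⟩ := Metric.uniformContinuous_iff.1 hu η hη
  let φ : ContDiffBump (0 : V) := ⟨δ / 2, δ, half_pos hδ, half_lt_self hδ⟩
  have hint : ∀ x, MeasureTheory.Integrable (fun t => φ.normed μ t * G (x - t)) μ := fun x =>
    (φ.continuous_normed.mul
      (hu.continuous.comp (continuous_const.sub continuous_id))).integrable_of_hasCompactSupport
      φ.hasCompactSupport_normed.mul_right
  refine ⟨fun x => ∫ t, φ.normed μ t * G (x - t) ∂μ, ?_, fun x y => ?_, fun x => ?_⟩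
  · exact φ.hasCompactSupport_normed.contDiff_convolution_left (ContinuousLinearMap.lsmul ℝ ℝ)
      φ.contDiff_normed hu.continuous.locallyIntegrable
  -- Every translate of `G` obeys the same increment bound, and the mollifier averages translates.
  · rw [← MeasureTheory.integral_sub (hint x) (hint y)]
    calc ∫ t, (φ.normed μ t * G (x - t) - φ.normed μ t * G (y - t)) ∂μ
        ≤ ∫ t, φ.normed μ t * Q (x - y) ∂μ := by
          refine MeasureTheory.integral_mono ((hint x).sub (hint y))
            (φ.integrable_normed.mul_const _) fun t => ?_
          dsimp only
          rw [← mul_sub]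
          refine mul_le_mul_of_nonneg_left ?_ (φ.nonneg_normed t)
          simpa using hG (x - t) (y - t)
      _ = Q (x - y) := by rw [MeasureTheory.integral_mul_const, φ.integral_normed, one_mul]
  · exact φ.dist_normed_convolution_le (μ := μ) (x₀ := x) hu.continuous.aestronglyMeasurable
      fun y hy => (hGδ hy).le

theorem exists_thickening_fderiv_apply_le {F : V → ℝ} (hF : ContDiff ℝ ∞ F) {A : Set V}
    (hA : IsCompact A) (h : ∀ a ∈ A, ∀ v, fderiv ℝ F a v ≤ Q v) {ε : ℝ} (hε : 0 < ε) :
    ∃ δ > 0, ∀ x ∈ thickening δ A, ∀ v, fderiv ℝ F x v ≤ Q v + ε * ‖v‖ := by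
  have hc : Continuous (fderiv ℝ F) := hF.continuous_fderiv (by simp)
  obtain ⟨δ, hδ, hsub⟩ := hA.exists_thickening_subset_open
    (t := ⋃ a ∈ A, fderiv ℝ F ⁻¹' ball (fderiv ℝ F a) ε)
    (isOpen_biUnion fun a _ => isOpen_ball.preimage hc)
    (fun a ha => mem_biUnion ha (mem_ball_self hε))
  refine ⟨δ, hδ, fun x hx v => ?_⟩
  obtain ⟨a, ha, hxa⟩ := mem_iUnion₂.1 (hsub hx)
  have h1 : (fderiv ℝ F x - fderiv ℝ F a) v ≤ ε * ‖v‖ :=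
    (le_abs_self _).trans (ContinuousLinearMap.le_of_opNorm_le _ (mem_ball_iff_norm.1 hxa).le v)
  have h2 := h a ha v
  rw [sub_apply] at h1
  linarith

/-- The derivative bound can be integrated only along segments that stay near `A`. This settles
close pairs. For distant pairs, `F` is almost 0 at both points while `Q (x - y)` is almost
nonnegative by comparison with points of `A`; the error is absorbed by `ε * ‖x - y‖`. -/
theorem exists_thickening_sub_le (hQ : IsBoundedSublinear Q) {F : V → ℝ}
    (hF : Differentiable ℝ F) {A : Set V} (hFA : ∀ a ∈ A, F a = 0)
    (hQA : ∀ a ∈ A, ∀ b ∈ A, 0 ≤ Q (a - b)) {δ : ℝ} (hδ : 0 < δ)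
    (h : ∀ x ∈ thickening δ A, ∀ v, fderiv ℝ F x v ≤ Q v) {ε : ℝ} (hε : 0 < ε) :
    ∃ δ' > 0, δ' ≤ δ ∧ ∀ x ∈ thickening δ' A, ∀ y ∈ thickening δ' A,
      F x - F y ≤ Q (x - y) + ε * ‖x - y‖ := by
  obtain ⟨C, hC, hb⟩ := hQ.bound
  have hlocal : ∀ x y, (∀ z ∈ segment ℝ y x, z ∈ thickening δ A) → F x - F y ≤ Q (x - y) :=
    fun x y hs => sub_le_of_fderiv_apply_le hF fun z hz => h z (hs z hz) _
  have hseg : ∀ x y z : V, z ∈ segment ℝ y x → dist z y ≤ ‖x - y‖ := fun x y z hz => by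
    rw [← dist_eq_norm, dist_comm x y, dist_comm z y]
    have := dist_add_dist_of_mem_segment hz
    have := dist_nonneg (x := z) (y := x)
    linarith
  -- The first entry keeps short segments inside the `δ`-thickening. The second makes four errors of
  -- size `C * δ'` total at most `ε * δ / 2`, hence at most `ε * ‖x - y‖` for distant pairs.
  set δ' := min (δ / 2) (ε * δ / (8 * (C + 1))) with hδ'
  have h1 : δ' ≤ δ / 2 := min_le_left _ _
  have hpos : 0 < δ' := by positivity
  have h2 : C * δ' ≤ ε * δ / 8 := by
    have h3 : δ' ≤ ε * δ / (8 * (C + 1)) := min_le_right _ _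
    rw [le_div_iff₀ (by positivity)] at h3
    linarith
  have hnear : ∀ x a, a ∈ A → dist x a < δ' → |F x| ≤ C * δ' ∧ |Q (x - a)| ≤ C * δ' ∧
      |Q (a - x)| ≤ C * δ' := by
    intro x a ha hx
    have hball : ∀ z, dist z a ≤ dist x a → z ∈ thickening δ A := fun z hz =>
      mem_thickening_iff.2 ⟨a, ha, by linarith⟩
    have e1 : |Q (x - a)| ≤ C * δ' := (hb _).trans
      (mul_le_mul_of_nonneg_left (by rw [← dist_eq_norm]; exact hx.le) hC)
    have e2 : |Q (a - x)| ≤ C * δ' := (hb _).trans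
      (mul_le_mul_of_nonneg_left (by rw [← dist_eq_norm, dist_comm]; exact hx.le) hC)
    have f1 := hlocal x a fun z hz => hball z ((hseg x a z hz).trans_eq (dist_eq_norm x a).symm)
    have f2 := hlocal a x fun z hz => hball z ((hseg x a z (segment_symm ℝ x a ▸ hz)).trans_eq
      (dist_eq_norm x a).symm)
    rw [hFA a ha] at f1 f2
    refine ⟨abs_le.2 ⟨?_, ?_⟩, e1, e2⟩
    · linarith [(abs_le.1 e2).2]
    · linarith [(abs_le.1 e1).2]
  refine ⟨δ', hpos, by linarith, fun x hx y hy => ?_⟩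
  obtain ⟨b, hb', hyb⟩ := mem_thickening_iff.1 hy
  obtain ⟨a, ha', hxa⟩ := mem_thickening_iff.1 hx
  rcases lt_or_ge ‖x - y‖ (δ / 2) with hlt | hge
  · have := hlocal x y fun z hz => mem_thickening_iff.2 ⟨b, hb', by
      have := hseg x y z hz
      have := dist_triangle z y b
      linarith⟩
    have : 0 ≤ ε * ‖x - y‖ := by positivity
    linarith
  · obtain ⟨x1, x2, x3⟩ := hnear x a ha' hxa
    obtain ⟨y1, y2, y3⟩ := hnear y b hb' hyb
    have t1 := hQ.map_add_le (a - x) (x - y)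
    have t2 := hQ.map_add_le (a - y) (y - b)
    rw [sub_add_sub_cancel] at t1 t2
    have t3 := hQA a ha' b hb'
    have t4 := mul_le_mul_of_nonneg_left hge hε.le
    linarith [(abs_le.1 x1).2, (abs_le.1 y1).1, (abs_le.1 x3).2, (abs_le.1 y2).2]

/-- A smooth function vanishing on a compact set `A` and with controlled derivative on `A` can be
modified away from `A` so that its derivative is controlled everywhere. -/
theorem exists_contDiff_fderiv_apply_le_of_compact [FiniteDimensional ℝ V]
    (hP : IsBoundedSublinear P) {A : Set V} (hA : IsCompact A) (hne : A.Nonempty)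
    (hPA : ∀ a ∈ A, ∀ b ∈ A, 0 ≤ P (a - b)) {f : V → ℝ} (hf : ContDiff ℝ ∞ f)
    (hfA : ∀ a ∈ A, f a = 0) (h : ∀ a ∈ A, ∀ v, fderiv ℝ f a v ≤ P v) {ε : ℝ} (hε : 0 < ε) :
    ∃ F : V → ℝ, ContDiff ℝ ∞ F ∧ (∀ a ∈ A, F a = 0) ∧
      ∀ x v, fderiv ℝ F x v ≤ P v + ε * ‖v‖ := by
  -- One third each for leaving `A` in the derivative bound, for passing to increments, and for the
  -- derivative of the cutoff.
  have hε3 : 0 < ε / 3 := by positivity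
  obtain ⟨δ₀, hδ₀, h₀⟩ := exists_thickening_fderiv_apply_le hf hA h hε3
  have hQ := hP.add_norm hε3.le
  obtain ⟨δ, hδ, hδle, h₁⟩ := exists_thickening_sub_le hQ (hf.differentiable (by simp)) hfA
    (fun a ha b hb => add_nonneg (hPA a ha b hb) (by positivity)) hδ₀ h₀ hε3
  have hR := hQ.add_norm hε3.le
  obtain ⟨G, hGf, hG⟩ := exists_extension_sub_le hR
    (hne.mono (self_subset_thickening hδ A)) h₁
  obtain ⟨χ, hχ0, hχ1, hχ⟩ := exists_contMDiffMap_zero_one_of_isClosed 𝓘(ℝ, V)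
    (isOpen_thickening (δ := δ / 2) (E := A)).isClosed_compl hA.isClosed
    (disjoint_compl_left_iff_subset.2 (self_subset_thickening (half_pos hδ) A))
  have hχs : ContDiff ℝ ∞ χ := χ.contMDiff.contDiff
  have hts : tsupport χ ⊆ cthickening (δ / 2) A := by
    refine closure_minimal (fun x hx => ?_) isClosed_cthickening
    by_contra hx'
    exact hx (hχ0 fun h' => hx' (thickening_subset_cthickening _ _ h'))
  have hcs : HasCompactSupport χ := hA.cthickening.of_isClosed_subset (isClosed_tsupport _) hts
  have hts' : tsupport χ ⊆ thickening δ A :=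
    hts.trans (cthickening_subset_thickening' hδ (half_lt_self hδ) A)
  obtain ⟨K, hK⟩ := (hχs.continuous_fderiv (by simp)).bounded_above_of_compact_support
    (hcs.fderiv (𝕜 := ℝ))
  have hK0 : 0 ≤ K := (norm_nonneg _).trans (hK 0)
  -- This `η` makes the product rule term `(f - g) dχ` at most `ε / 3 * ‖v‖`, since `f = G` on the
  -- thickening and `‖dχ‖ ≤ K`. The other terms form a convex combination of `df` and `dg`.
  obtain ⟨g, hg, hgQ, hgG⟩ := exists_contDiff_sub_le hR hG (η := ε / (3 * (K + 1)))
    (by positivity)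
  have hgd := fderiv_apply_le_of_sub_le hR hgQ (hg.differentiable (by simp))
  refine ⟨fun x => g x + χ x * (f x - g x), hg.add (hχs.mul (hf.sub hg)), fun a ha => ?_,
    fun x v => ?_⟩
  · have : χ a = 1 := hχ1 ha
    simp [this, hfA a ha]
  · have dχ := (hχs.differentiable (by simp) x).hasFDerivAt
    have df := (hf.differentiable (by simp) x).hasFDerivAt
    have dg := (hg.differentiable (by simp) x).hasFDerivAt
    have hd := (dg.add (dχ.mul (df.sub dg))).fderiv
    change fderiv ℝ (fun x => g x + χ x * (f x - g x)) x = _ at hd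
    rw [hd]
    have hv : 0 ≤ ‖v‖ := norm_nonneg v
    have hgv := hgd x v
    simp only [add_apply, smul_apply,
      sub_apply, Pi.sub_apply, smul_eq_mul]
    by_cases hx : x ∈ thickening δ A
    · have hfv := h₀ x (thickening_mono hδle A hx) v
      have h3 : |f x - g x| * |fderiv ℝ χ x v| ≤ ε / (3 * (K + 1)) * (K * ‖v‖) := by
        refine mul_le_mul ?_ (ContinuousLinearMap.le_of_opNorm_le _ (hK x) v) (abs_nonneg _)
          (by positivity)
        rw [← hGf x hx, abs_sub_comm]
        exact hgG x
      have h4 : ε / (3 * (K + 1)) * (K * ‖v‖) ≤ ε / 3 * ‖v‖ := by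
        rw [← mul_assoc]
        refine mul_le_mul_of_nonneg_right ?_ hv
        rw [div_mul_eq_mul_div, div_le_div_iff₀ (by positivity) (by positivity)]
        nlinarith
      have h5 := (le_abs_self _).trans_eq (abs_mul (f x - g x) (fderiv ℝ χ x v))
      have h6 := (hχ x).1
      have h7 := (hχ x).2
      have h8 : 0 ≤ ε / 3 * ‖v‖ := by positivity
      nlinarith [mul_le_mul_of_nonneg_left (hfv.trans (le_add_of_nonneg_right h8)) h6,
        mul_le_mul_of_nonneg_left hgv (sub_nonneg.2 h7)]
    · have hx' : x ∉ tsupport χ := fun h' => hx (hts' h')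
      rw [fderiv_of_notMem_tsupport ℝ hx', image_eq_zero_of_notMem_tsupport hx']
      simp only [zero_mul, zero_apply, mul_zero, add_zero]
      have : 0 ≤ ε / 3 * ‖v‖ := by positivity
      linarith

/-- Gluing local defining functions by a partition of unity. -/
theorem exists_contDiff_fderiv_apply_le_of_local [FiniteDimensional ℝ V] {A : Set V}
    (hA : IsCompact A)
    (hloc : ∀ a ∈ A, ∃ (U : Set V) (f : V → ℝ), IsOpen U ∧ a ∈ U ∧ ContDiffOn ℝ ∞ f U ∧
      (∀ x ∈ A ∩ U, f x = 0) ∧ ∀ x ∈ U, ∀ v, fderiv ℝ f x v ≤ Q v) :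
    ∃ F : V → ℝ, ContDiff ℝ ∞ F ∧ (∀ a ∈ A, F a = 0) ∧ ∀ a ∈ A, ∀ v, fderiv ℝ F a v ≤ Q v := by
  choose! U f hU haU hf hf0 hfQ using hloc
  obtain ⟨t, htA, hcov⟩ := hA.elim_nhds_subcover U fun a ha => (hU a ha).mem_nhds (haU a ha)
  obtain ⟨ρ, hρ⟩ := SmoothPartitionOfUnity.exists_isSubordinate 𝓘(ℝ, V) hA.isClosed
    (fun i : t => U i) (fun i => hU i (htA i i.2)) (by simpa [iUnion_subtype] using hcov)
  have hsm := hρ.contMDiff_finsum_smul (n := (⊤ : ℕ∞)) (g := fun i : t => f i)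
    (fun i => hU i (htA i i.2)) (fun i => (hf i (htA i i.2)).contMDiffOn)
  simp only [finsum_eq_sum_of_fintype] at hsm
  refine ⟨_, hsm.contDiff, fun a ha => ?_, fun a ha v => ?_⟩
  · refine Finset.sum_eq_zero fun i _ => ?_
    by_cases hai : a ∈ U i
    · rw [hf0 i (htA i i.2) a ⟨ha, hai⟩, smul_zero]
    · rw [image_eq_zero_of_notMem_tsupport fun h => hai (hρ i h), zero_smul]
  -- As `f i` vanishes on `A`, the term containing `dρ i` drops out, and the derivative at `a` is a
  -- convex combination.
  · have hd : ∀ i : t, HasFDerivAt (fun x => ρ i x • f i x) (ρ i a • fderiv ℝ (f i) a) a := by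
      intro i
      by_cases hai : a ∈ U i
      · have d1 := (((hf i (htA i i.2)).contDiffAt
          ((hU i (htA i i.2)).mem_nhds hai)).differentiableAt (by simp)).hasFDerivAt
        have d2 := ((ρ i).contMDiff.contDiff.differentiable (by simp) a).hasFDerivAt
        have d := d2.smul d1
        rw [hf0 i (htA i i.2) a ⟨ha, hai⟩, ContinuousLinearMap.smulRight_zero, add_zero] at d
        exact d
      · have hn : a ∉ tsupport (ρ i) := fun h => hai (hρ i h)
        rw [image_eq_zero_of_notMem_tsupport hn, zero_smul]
        refine (hasFDerivAt_const (0 : ℝ) a).congr_of_eventuallyEq ?_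
        filter_upwards [notMem_tsupport_iff_eventuallyEq.1 hn] with x hx
        simp [hx]
    have h1 : ∑ i : t, ρ i a = 1 := by
      rw [← finsum_eq_sum_of_fintype]
      exact ρ.sum_eq_one ha
    rw [(HasFDerivAt.fun_sum fun i _ => hd i).fderiv, sum_apply]
    calc ∑ i : t, (ρ i a • fderiv ℝ (f i) a) v ≤ ∑ i : t, ρ i a * Q v := by
          refine Finset.sum_le_sum fun i _ => ?_
          rw [smul_apply, smul_eq_mul]
          by_cases hai : a ∈ U i
          · exact mul_le_mul_of_nonneg_left (hfQ i (htA i i.2) a hai v) (ρ.nonneg i a)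
          · rw [image_eq_zero_of_notMem_tsupport fun h => hai (hρ i h), zero_mul, zero_mul]
      _ = Q v := by rw [← Finset.sum_mul, h1, one_mul]

/-- Near a point of a smooth local neighbourhood retract whose differences lie in `{0 ≤ P}` there is
a defining function whose derivative is controlled by `P`. -/
theorem exists_local_fderiv_apply_le [FiniteDimensional ℝ V] (hP : IsBoundedSublinear P)
    {A : Set V} (hPA : ∀ a ∈ A, ∀ b ∈ A, 0 ≤ P (a - b)) {a : V} (ha : a ∈ A) {W : Set V}
    (hW : IsOpen W) (haW : a ∈ W) {r : V → V} (hr : ContDiffOn ℝ ∞ r W) (hrA : MapsTo r W A)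
    (hrid : ∀ x ∈ A ∩ W, r x = x) {ε : ℝ} (hε : 0 < ε) :
    ∃ (U : Set V) (f : V → ℝ), IsOpen U ∧ a ∈ U ∧ ContDiffOn ℝ ∞ f U ∧
      (∀ x ∈ A ∩ U, f x = 0) ∧ ∀ x ∈ U, ∀ v, fderiv ℝ f x v ≤ P v + ε * ‖v‖ := by
  have hdr := ((hr.contDiffAt (hW.mem_nhds haW)).differentiableAt (by simp)).hasFDerivAt
  set r' := fderiv ℝ r a
  have hra : r a = a := hrid a ⟨ha, haW⟩
  -- `r' v` is a limit of positive multiples of differences of points of `A`.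
  have htan : ∀ v, 0 ≤ P (r' v) := by
    intro v
    refine ge_of_tendsto ((hP.continuous.tendsto _).comp (hdr.tendsto_slope_ray v)) ?_
    have hc : Filter.Tendsto (fun t : ℝ => a + t • v) (𝓝[>] 0) (𝓝 a) := by
      have : Continuous fun t : ℝ => a + t • v := by fun_prop
      simpa using (this.tendsto 0).mono_left nhdsWithin_le_nhds
    filter_upwards [self_mem_nhdsWithin, hc (hW.mem_nhds haW)] with t (ht : 0 < t) htW
    rw [Function.comp_apply, hP.map_smul _ (inv_pos.2 ht)]
    exact mul_nonneg (inv_pos.2 ht).le (hPA _ (hrA htW) _ (hrA haW))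
  -- Hahn–Banach, starting from the zero functional on the range of `r'`. Since `l` kills this
  -- range, `L (x - r x)` has derivative exactly `L` at `a`.
  obtain ⟨l, hl0, hlP⟩ := exists_extension_of_le_sublinear
    (⟨LinearMap.range (r' : V →ₗ[ℝ] V), 0⟩ : V →ₗ.[ℝ] ℝ) P hP.map_smul hP.map_add_le (by
      rintro ⟨_, v, rfl⟩
      exact htan v)
  have hlr : ∀ v, l (r' v) = 0 := fun v => hl0 ⟨r' v, v, rfl⟩
  let L : V →L[ℝ] ℝ := LinearMap.toContinuousLinearMap l
  have hf : ContDiffOn ℝ ∞ (fun x => L (x - r x)) W := L.contDiff.comp_contDiffOn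
    (contDiffOn_id.sub hr)
  have hfa : fderiv ℝ (fun x => L (x - r x)) a = L := by
    have := (L.hasFDerivAt.comp a ((hasFDerivAt_id a).sub hdr)).fderiv
    refine this.trans ?_
    ext v
    change l (v - r' v) = l v
    rw [map_sub, hlr, sub_zero]
  have hcont := hf.continuousOn_fderiv_of_isOpen hW (by simp)
  refine ⟨W ∩ fderiv ℝ (fun x => L (x - r x)) ⁻¹' ball L ε, fun x => L (x - r x),
    hcont.isOpen_inter_preimage hW isOpen_ball, ⟨haW, ?_⟩, hf.mono inter_subset_left, ?_, ?_⟩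
  · rw [mem_preimage, hfa]
    exact mem_ball_self hε
  · rintro x ⟨hxA, hxW, -⟩
    simp [hrid x ⟨hxA, hxW⟩]
  · rintro x ⟨-, hx⟩ v
    have h1 : (fderiv ℝ (fun x => L (x - r x)) x - L) v ≤ ε * ‖v‖ :=
      (le_abs_self _).trans (ContinuousLinearMap.le_of_opNorm_le _ (mem_ball_iff_norm.1 hx).le v)
    have h2 : L v ≤ P v := hlP v
    rw [sub_apply] at h1
    linarith

theorem exists_contDiff_fderiv_apply_le [FiniteDimensional ℝ V] (hP : IsBoundedSublinear P)
    {A : Set V} (hA : IsCompact A) (hne : A.Nonempty)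
    (hPA : ∀ a ∈ A, ∀ b ∈ A, 0 ≤ P (a - b))
    (hret : ∀ a ∈ A, ∃ (W : Set V) (r : V → V), IsOpen W ∧ a ∈ W ∧ ContDiffOn ℝ ∞ r W ∧
      MapsTo r W A ∧ ∀ x ∈ A ∩ W, r x = x) {ε : ℝ} (hε : 0 < ε) :
    ∃ F : V → ℝ, ContDiff ℝ ∞ F ∧ (∀ a ∈ A, F a = 0) ∧
      ∀ x v, fderiv ℝ F x v ≤ P v + ε * ‖v‖ := by
  have hε2 : 0 < ε / 2 := half_pos hε
  obtain ⟨f, hf, hf0, hfP⟩ := exists_contDiff_fderiv_apply_le_of_local hA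
    (Q := fun v => P v + ε / 2 * ‖v‖) fun a ha => by
      obtain ⟨W, r, hW, haW, hr, hrA, hrid⟩ := hret a ha
      exact exists_local_fderiv_apply_le hP hPA ha hW haW hr hrA hrid hε2
  obtain ⟨F, hF, hF0, hFP⟩ := exists_contDiff_fderiv_apply_le_of_compact (hP.add_norm hε2.le) hA
    hne (fun a ha b hb => add_nonneg (hPA a ha b hb) (by positivity)) hf hf0 hfP hε2
  exact ⟨F, hF, hF0, fun x v => (hFP x v).trans_eq (by ring)⟩

end Sublinear

/-! ### Local retractions onto an embedded manifold. -/

/-- The image of a smooth embedding is locally a smooth neighbourhood retract. -/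
theorem Manifold.IsSmoothEmbedding.exists_local_retraction
    {E V M : Type*} [NormedAddCommGroup E] [NormedSpace ℝ E] [NormedAddCommGroup V]
    [NormedSpace ℝ V] [TopologicalSpace M] [ChartedSpace E M] {f : M → V}
    (hf : Manifold.IsSmoothEmbedding 𝓘(ℝ, E) 𝓘(ℝ, V) ∞ f) {a : V} (ha : a ∈ range f) :
    ∃ (W : Set V) (r : V → V), IsOpen W ∧ a ∈ W ∧ ContDiffOn ℝ ∞ r W ∧
      MapsTo r W (range f) ∧ ∀ x ∈ range f ∩ W, r x = x := by
  obtain ⟨x₀, rfl⟩ := ha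
  have h := hf.isImmersion.isImmersionAt x₀
  set φ := h.domChart
  set ψ := h.codChart
  set e := h.equiv
  have hψ := contMDiffOn_iff_contDiffOn.1
    (contMDiffOn_of_mem_maximalAtlas h.codChart_mem_maximalAtlas)
  have hψs := contMDiffOn_iff_contDiffOn.1
    (contMDiffOn_symm_of_mem_maximalAtlas h.codChart_mem_maximalAtlas)
  have hmaps : ∀ x ∈ φ.source, f x ∈ ψ.source := h.source_subset_preimage_source
  have hw : ∀ u ∈ φ.target, ψ (f (φ.symm u)) = e (u, 0) := fun u hu => by
    have hu' : u ∈ (φ.extend 𝓘(ℝ, E)).target := by simpa using hu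
    have := h.writtenInCharts hu'
    simpa using this
  have hw' : ∀ u ∈ φ.target, e (u, 0) ∈ ψ.target ∧ ψ.symm (e (u, 0)) = f (φ.symm u) :=
    fun u hu => by
      have hs := hmaps _ (φ.map_target hu)
      rw [← hw u hu]
      exact ⟨ψ.map_source hs, ψ.left_inv hs⟩
  -- Being a topological embedding matters here: `O` excludes points of the image that come back
  -- near `a` from outside the chart domain.
  obtain ⟨O, hO, hOφ⟩ := hf.isEmbedding.isInducing.isOpen_iff.1 φ.open_source
  -- In the adapted charts `f` is `u ↦ (u, 0)`; the retraction sets the second coordinate to 0.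
  let p : V → E := fun y => (e.symm (ψ y)).1
  have hp : ContDiffOn ℝ ∞ p ψ.source := contDiff_fst.comp_contDiffOn
    (e.symm.contDiff.comp_contDiffOn hψ)
  have hpf : ∀ x ∈ φ.source, p (f x) = φ x := fun x hx => by
    have := hw (φ x) (φ.map_source hx)
    rw [φ.left_inv hx] at this
    simp [p, this]
  refine ⟨(ψ.source ∩ p ⁻¹' φ.target) ∩ O, fun y => ψ.symm (e (p y, 0)),
    (hp.continuousOn.isOpen_inter_preimage ψ.open_source φ.open_target).inter hO,
    ⟨⟨h.mem_codChart_source, ?_⟩, ?_⟩, ?_, ?_, ?_⟩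
  · rw [mem_preimage, hpf _ h.mem_domChart_source]
    exact φ.map_source h.mem_domChart_source
  · have : x₀ ∈ f ⁻¹' O := hOφ ▸ h.mem_domChart_source
    exact this
  · refine hψs.comp (e.contDiff.comp_contDiffOn ((hp.mono ?_).prodMk contDiffOn_const)) ?_
    · exact fun y hy => hy.1.1
    · exact fun y hy => (hw' _ hy.1.2).1
  · intro y hy
    exact ⟨φ.symm (p y), (hw' _ hy.1.2).2.symm⟩
  · rintro _ ⟨⟨x, rfl⟩, -, hxO⟩
    have hx : x ∈ φ.source := by rw [← hOφ]; exact hxO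
    dsimp only
    rw [hpf x hx, (hw' _ (φ.map_source hx)).2, φ.left_inv hx]

/-! ### Quadratic form, trace and norm of symmetric matrices. -/

noncomputable instance (n : ℕ) : FiniteDimensional ℝ (SymMat n) :=
  inferInstanceAs (FiniteDimensional ℝ (selfAdjoint.submodule ℝ (Matrix (Fin n) (Fin n) ℝ)))

namespace SymMat

variable {n : ℕ}

/-- The entries of a symmetric matrix, as linear functionals. -/
def entry (i j : Fin n) : SymMat n →ₗ[ℝ] ℝ where
  toFun a := (a : Matrix (Fin n) (Fin n) ℝ) i j
  map_add' _ _ := rfl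
  map_smul' _ _ := rfl

theorem norm_sq_eq (a : SymMat n) : ‖a‖ ^ 2 = ∑ i, ∑ j, entry i j a ^ 2 := by
  have h : ‖a‖ = (∑ i, ∑ j, ‖entry i j a‖ ^ (2 : ℝ)) ^ (1 / 2 : ℝ) :=
    Matrix.frobenius_norm_def (a : Matrix (Fin n) (Fin n) ℝ)
  rw [h, ← Real.sqrt_eq_rpow, Real.sq_sqrt (by positivity)]
  simp

theorem abs_entry_le (a : SymMat n) (i j : Fin n) : |entry i j a| ≤ ‖a‖ := by
  refine abs_le_of_sq_le_sq ?_ (norm_nonneg _)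
  rw [norm_sq_eq]
  calc entry i j a ^ 2 ≤ ∑ j, entry i j a ^ 2 :=
        Finset.single_le_sum (f := fun j => entry i j a ^ 2) (fun _ _ => sq_nonneg _)
          (Finset.mem_univ j)
    _ ≤ _ := Finset.single_le_sum (f := fun i => ∑ j, entry i j a ^ 2)
          (fun _ _ => Finset.sum_nonneg fun _ _ => sq_nonneg _) (Finset.mem_univ i)

/-- The quadratic form of a symmetric matrix, linear in the matrix. -/
noncomputable def quad (ξ : EuclideanSpace ℝ (Fin n)) : SymMat n →ₗ[ℝ] ℝ :=
  ∑ i, ∑ j, (ξ i * ξ j) • entry i j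

theorem quad_apply (ξ : EuclideanSpace ℝ (Fin n)) (a : SymMat n) :
    quad ξ a = ∑ i, ∑ j, ξ i * ξ j * entry i j a := by
  simp [quad]

theorem quad_eq_dotProduct (ξ : EuclideanSpace ℝ (Fin n)) (a : SymMat n) :
    quad ξ a = star ξ.ofLp ⬝ᵥ ((a : Matrix (Fin n) (Fin n) ℝ).mulVec ξ.ofLp) := by
  simp only [quad_apply, dotProduct, Matrix.mulVec, Finset.mul_sum, Pi.star_apply, star_trivial]
  exact Finset.sum_congr rfl fun i _ => Finset.sum_congr rfl fun j _ => by
    rw [mul_assoc, mul_comm (ξ j)]; rfl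

theorem abs_quad_le {ξ : EuclideanSpace ℝ (Fin n)} (hξ : ‖ξ‖ = 1) (a : SymMat n) :
    |quad ξ a| ≤ n ^ 2 * ‖a‖ := by
  rw [quad_apply]
  have hc : ∀ i, |ξ i| ≤ 1 := fun i => hξ ▸ PiLp.norm_apply_le ξ i
  calc |∑ i, ∑ j, ξ i * ξ j * entry i j a| ≤ ∑ i : Fin n, ∑ j : Fin n, ‖a‖ := by
        refine (Finset.abs_sum_le_sum_abs _ _).trans (Finset.sum_le_sum fun i _ =>
          (Finset.abs_sum_le_sum_abs _ _).trans (Finset.sum_le_sum fun j _ => ?_))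
        rw [abs_mul, abs_mul]
        exact (mul_le_mul (mul_le_one₀ (hc i) (abs_nonneg _) (hc j)) (abs_entry_le a i j)
          (abs_nonneg _) zero_le_one).trans_eq (one_mul _)
    _ = n ^ 2 * ‖a‖ := by simp; ring

theorem entry_rankOne (ξ : EuclideanSpace ℝ (Fin n)) (i j : Fin n) :
    entry i j (rankOne ξ) = ξ i * ξ j := rfl

theorem norm_rankOne (ξ : EuclideanSpace ℝ (Fin n)) : ‖rankOne ξ‖ = ‖ξ‖ ^ 2 := by
  rw [← sq_eq_sq₀ (norm_nonneg _) (by positivity), norm_sq_eq, EuclideanSpace.real_norm_sq_eq,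
    sq (∑ i, ξ i ^ 2), Finset.sum_mul_sum]
  simp [entry_rankOne, mul_pow]

theorem quad_rankOne (ξ η : EuclideanSpace ℝ (Fin n)) :
    quad η (rankOne ξ) = (∑ i, ξ i * η i) ^ 2 := by
  rw [quad_apply, sq, Finset.sum_mul_sum]
  exact Finset.sum_congr rfl fun i _ => Finset.sum_congr rfl fun j _ => by
    rw [entry_rankOne]; ring

/-- The trace of a symmetric matrix. -/
noncomputable def traceForm : SymMat n →ₗ[ℝ] ℝ :=
  ∑ i, entry i i

theorem traceForm_apply (a : SymMat n) :
    traceForm a = (a : Matrix (Fin n) (Fin n) ℝ).trace := by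
  simp only [traceForm, LinearMap.sum_apply]
  rfl

theorem traceForm_rankOne (ξ : EuclideanSpace ℝ (Fin n)) : traceForm (rankOne ξ) = ‖ξ‖ ^ 2 := by
  rw [EuclideanSpace.real_norm_sq_eq]
  simp [traceForm, entry_rankOne, sq]

theorem abs_traceForm_le (a : SymMat n) : |traceForm a| ≤ n * ‖a‖ := by
  simp only [traceForm, LinearMap.sum_apply]
  refine (Finset.abs_sum_le_sum_abs _ _).trans
    ((Finset.sum_le_sum fun i _ => abs_entry_le a i i).trans_eq (by simp))

/-- The supremum of the quadratic form over the unit sphere. -/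
noncomputable def maxQuad (a : SymMat n) : ℝ :=
  ⨆ ξ : sphere (0 : EuclideanSpace ℝ (Fin n)) 1, quad (ξ : EuclideanSpace ℝ (Fin n)) a

theorem bddAbove_quad (a : SymMat n) :
    BddAbove (range fun ξ : sphere (0 : EuclideanSpace ℝ (Fin n)) 1 =>
      quad (ξ : EuclideanSpace ℝ (Fin n)) a) := by
  refine ⟨n ^ 2 * ‖a‖, ?_⟩
  rintro _ ⟨ξ, rfl⟩
  exact (le_abs_self _).trans (abs_quad_le (mem_sphere_zero_iff_norm.1 ξ.2) a)

theorem quad_le_maxQuad {ξ : EuclideanSpace ℝ (Fin n)} (hξ : ‖ξ‖ = 1) (a : SymMat n) :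
    quad ξ a ≤ maxQuad a :=
  le_ciSup (bddAbove_quad a) ⟨ξ, mem_sphere_zero_iff_norm.2 hξ⟩

theorem eigenvalues_le_maxQuad (a : SymMat n) (i : Fin n) :
    a.isHermitian.eigenvalues i ≤ maxQuad a := by
  rw [a.isHermitian.eigenvalues_eq i]
  refine le_of_eq_of_le ?_ (quad_le_maxQuad (a.isHermitian.eigenvectorBasis.orthonormal.1 i) a)
  rw [quad_eq_dotProduct]
  rfl

theorem card_mul_minEigenvalue_le (a : SymMat n) : n * a.minEigenvalue ≤ traceForm a := by
  rw [traceForm_apply, a.isHermitian.trace_eq_sum_eigenvalues]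
  calc (n : ℝ) * a.minEigenvalue = ∑ i : Fin n, a.minEigenvalue := by simp
    _ ≤ _ := Finset.sum_le_sum fun i _ => ciInf_le (Finite.bddBelow_range _) i

/-- Write `a = Bᵀ B`; the vectors are the rows of `B`. Ellipticity, stated for rank one directions,
thereby reaches all positive semidefinite ones. -/
theorem exists_sum_rankOne {a : SymMat n} (ha : ∀ ξ, 0 ≤ quad ξ a) :
    ∃ v : Fin n → EuclideanSpace ℝ (Fin n), a = ∑ k, rankOne (v k) := by
  have hpos : (a : Matrix (Fin n) (Fin n) ℝ).PosSemidef :=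
    .of_dotProduct_mulVec_nonneg a.isHermitian fun x => by
      have := ha (WithLp.toLp 2 x)
      rwa [quad_eq_dotProduct] at this
  obtain ⟨B, hB⟩ : ∃ B : Matrix (Fin n) (Fin n) ℝ, (a : Matrix (Fin n) (Fin n) ℝ) = star B * B := by
    open scoped MatrixOrder Matrix.Norms.L2Operator in
    exact CStarAlgebra.nonneg_iff_eq_star_mul_self.mp hpos.nonneg
  refine ⟨fun k => WithLp.toLp 2 (B k), Subtype.ext ?_⟩
  have hcoe : ((∑ k, rankOne (WithLp.toLp 2 (B k)) : SymMat n) : Matrix (Fin n) (Fin n) ℝ) =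
      ∑ k, (rankOne (WithLp.toLp 2 (B k)) : Matrix (Fin n) (Fin n) ℝ) :=
    map_sum (selfAdjoint.submodule ℝ (Matrix (Fin n) (Fin n) ℝ)).subtype _ _
  refine hB.trans (Eq.trans ?_ hcoe.symm)
  ext i j
  rw [Matrix.sum_apply, Matrix.mul_apply]
  rfl

end SymMat

open SymMat

/-! ### Monotonicity, and one-sided derivative tests. -/

/-- A uniformly elliptic function is monotone. -/
theorem IsUniformlyElliptic.monotone_quad {n : ℕ} {F : SymMat n → ℝ} (hF : IsUniformlyElliptic F)
    {a b : SymMat n} (h : ∀ ξ, quad ξ a ≤ quad ξ b) : F a ≤ F b := by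
  obtain ⟨hd, Λ, hΛ, hell⟩ := hF
  obtain ⟨v, hv⟩ := exists_sum_rankOne (a := b - a) fun ξ => by
    rw [map_sub]; exact sub_nonneg.2 (h ξ)
  obtain ⟨z, -, hz⟩ := domain_mvt (f := F) (s := univ) (x := a) (y := b)
    (fun z _ => (hd z).hasFDerivAt.hasFDerivWithinAt) convex_univ (mem_univ _) (mem_univ _)
  rw [← sub_nonneg, hz, hv, map_sum]
  exact Finset.sum_nonneg fun k _ => le_trans (by positivity) (hell z (v k)).1

theorem HasDerivAt.nonneg_of_eventually_le_right {h : ℝ → ℝ} {c : ℝ} (hd : HasDerivAt h c 0)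
    (hle : ∀ᶠ t in 𝓝[>] 0, h 0 ≤ h t) : 0 ≤ c := by
  refine ge_of_tendsto hd.tendsto_slope_zero_right ?_
  filter_upwards [hle, self_mem_nhdsWithin] with t ht (ht0 : 0 < t)
  rw [zero_add, smul_eq_mul]
  exact mul_nonneg (inv_pos.2 ht0).le (sub_nonneg.2 ht)

/-- The one-sided second order necessary condition for a minimum. -/
theorem HasDerivAt.second_nonneg_of_eventually_le_right {h h' : ℝ → ℝ} {c : ℝ}
    (hd : ∀ᶠ t in 𝓝 0, HasDerivAt h (h' t) t) (hd' : HasDerivAt h' c 0) (h0 : h' 0 = 0)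
    (hle : ∀ᶠ t in 𝓝[>] 0, h 0 ≤ h t) : 0 ≤ c := by
  by_contra! hc
  -- If `c < 0`, then `g` still has second derivative `c / 2 < 0` at 0, hence a local maximum, so `h
  -- t ≤ h 0 + c / 4 * t ^ 2 < h 0` for small `t > 0`.
  let g : ℝ → ℝ := fun t => h t - c / 4 * t ^ 2
  have hg : ∀ᶠ t in 𝓝 0, HasDerivAt g (h' t - c / 2 * t) t := by
    filter_upwards [hd] with t ht
    exact (ht.sub ((hasDerivAt_pow 2 t).const_mul (c / 4))).congr_deriv (by simp; ring)
  have hg' : _root_.deriv g =ᶠ[𝓝 0] fun t => h' t - c / 2 * t := hg.mono fun t ht => ht.deriv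
  have hg'' : _root_.deriv (_root_.deriv g) 0 = c / 2 := by
    rw [hg'.deriv_eq]
    exact ((hd'.sub ((hasDerivAt_id (0 : ℝ)).const_mul (c / 2))).congr_deriv (by ring)).deriv
  have hmax : IsLocalMax g 0 := isLocalMax_of_deriv_deriv_neg (by rw [hg'']; linarith)
    (by simp [hg'.self_of_nhds, h0]) hg.self_of_nhds.continuousAt
  have hev : ∀ᶠ t : ℝ in 𝓝[>] 0, False := by
    filter_upwards [hle, hmax.filter_mono nhdsWithin_le_nhds, self_mem_nhdsWithin]
      with t h1 h2 (ht : 0 < t)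
    have h3 : h t - c / 4 * t ^ 2 ≤ h 0 - c / 4 * 0 ^ 2 := h2
    have h4 : 0 < t ^ 2 := by positivity
    nlinarith
  exact hev.exists.choose_spec

/-! ### Hessians through second derivatives along lines. -/

section Hessian

variable {n : ℕ} {u : EuclideanSpace ℝ (Fin n) → ℝ} {x : EuclideanSpace ℝ (Fin n)}

theorem quad_hessian (hu : ContDiffAt ℝ 2 u x) (ξ : EuclideanSpace ℝ (Fin n)) :
    quad ξ (hessian u x) = fderiv ℝ (fderiv ℝ u) x ξ ξ := by
  have hξ : ξ = ∑ i, ξ i • EuclideanSpace.single i (1 : ℝ) := by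
    simpa using ((EuclideanSpace.basisFun (Fin n) ℝ).sum_repr ξ).symm
  have he : ∀ i j, entry i j (hessian u x) = fderiv ℝ (fderiv ℝ u) x
      (EuclideanSpace.single i 1) (EuclideanSpace.single j 1) := fun i j =>
    congrFun (congrFun (coe_hessian hu) i) j
  conv_rhs => rw [hξ]
  simp only [map_sum, map_smul, sum_apply, smul_apply, quad_apply, he, smul_eq_mul,
    Finset.mul_sum]
  rw [Finset.sum_comm]
  exact Finset.sum_congr rfl fun i _ => Finset.sum_congr rfl fun j _ => by ring

theorem eventually_hasDerivAt_line (hu : ContDiffAt ℝ 2 u x) (ξ : EuclideanSpace ℝ (Fin n)) :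
    (∀ᶠ t : ℝ in 𝓝 0, HasDerivAt (fun t : ℝ => u (x + t • ξ)) (fderiv ℝ u (x + t • ξ) ξ) t) ∧
      HasDerivAt (fun t : ℝ => fderiv ℝ u (x + t • ξ) ξ) (fderiv ℝ (fderiv ℝ u) x ξ ξ) 0 := by
  have hline : ∀ t : ℝ, HasDerivAt (fun t : ℝ => x + t • ξ) ξ t := fun t => by
    simpa using ((hasDerivAt_id t).smul_const ξ).const_add x
  have hx : x + (0 : ℝ) • ξ = x := by simp
  constructor
  · have hev : ∀ᶠ y in 𝓝 x, ContDiffAt ℝ 2 u y := hu.eventually (by simp)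
    have hc : Filter.Tendsto (fun t : ℝ => x + t • ξ) (𝓝 0) (𝓝 x) := by
      simpa using (hline 0).continuousAt.tendsto
    filter_upwards [hc.eventually hev] with t ht
    exact (ht.differentiableAt (by simp)).hasFDerivAt.comp_hasDerivAt t (hline t)
  · have h1 : DifferentiableAt ℝ (fderiv ℝ u) x :=
      (hu.fderiv_right (m := 1) (by norm_num)).differentiableAt (by simp)
    have h2 : HasDerivAt (fun t : ℝ => fderiv ℝ u (x + t • ξ)) (fderiv ℝ (fderiv ℝ u) x ξ) 0 :=
      h1.hasFDerivAt.comp_hasDerivAt_of_eq (0 : ℝ) (hline 0) hx.symm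
    exact (h2.clm_apply (hasDerivAt_const (0 : ℝ) ξ)).congr_deriv (by simp)

theorem quad_hessian_le_of_isLocalMax {w φ : EuclideanSpace ℝ (Fin n) → ℝ}
    (hw : ContDiffAt ℝ 2 w x) (hφ : ContDiffAt ℝ 2 φ x)
    (hmax : IsLocalMax (fun y => w y - φ y) x) (ξ : EuclideanSpace ℝ (Fin n)) :
    quad ξ (hessian w x) ≤ quad ξ (hessian φ x) := by
  rw [quad_hessian hw, quad_hessian hφ]
  obtain ⟨w1, w2⟩ := eventually_hasDerivAt_line hw ξ
  obtain ⟨p1, p2⟩ := eventually_hasDerivAt_line hφ ξ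
  have hd := p1.and w1 |>.mono fun t h => h.1.sub h.2
  have hc : Filter.Tendsto (fun t : ℝ => x + t • ξ) (𝓝 0) (𝓝 x) := by
    have : Continuous fun t : ℝ => x + t • ξ := by fun_prop
    simpa using this.tendsto 0
  have hmin : IsLocalMin ((fun t : ℝ => φ (x + t • ξ)) - fun t : ℝ => w (x + t • ξ)) 0 := by
    filter_upwards [hc.eventually hmax] with t ht
    simp only [zero_smul, add_zero, Pi.sub_apply]
    linarith
  exact sub_nonneg.1 (HasDerivAt.second_nonneg_of_eventually_le_right hd (p2.sub w2)
    (hmin.hasDerivAt_eq_zero hd.self_of_nhds) (hmin.filter_mono nhdsWithin_le_nhds))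

theorem hessian_neg (u : EuclideanSpace ℝ (Fin n) → ℝ) (x : EuclideanSpace ℝ (Fin n)) :
    hessian (fun y => -u y) x = -hessian u x := by
  have h : hessianMatrix (fun y => -u y) x = -hessianMatrix u x := by
    ext i j
    have h1 : fderiv ℝ (fun y => -u y) = fun y => -fderiv ℝ u y := funext fun y => fderiv_fun_neg
    simp [hessianMatrix, h1]
  rw [hessian, h, map_neg]
  rfl

end Hessian

/-! ### Test functions touching a function homogeneous of order two. -/

section Homogeneous

variable {n : ℕ} {w : EuclideanSpace ℝ (Fin n) → ℝ}

theorem smul_fderiv_of_scaling {E G : Type*} [NormedAddCommGroup E] [NormedSpace ℝ E]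
    [NormedAddCommGroup G] [NormedSpace ℝ G] {g : E → G} {c t : ℝ} (hc : c ≠ 0)
    (h : ∀ x, g (t • x) = c • g x) (x : E) : t • fderiv ℝ g (t • x) = c • fderiv ℝ g x := by
  let _ := invertibleOfNonzero hc
  rw [← fderiv_comp_smul, ← fderiv_const_smul_of_invertible c]
  exact congrArg (fun k => fderiv ℝ k x) (funext h)

theorem hessian_smul_of_homogeneous (hom : ∀ t : ℝ, 0 < t → ∀ x, w (t • x) = t ^ 2 * w x)
    {t : ℝ} (ht : 0 < t) (x : EuclideanSpace ℝ (Fin n)) : hessian w (t • x) = hessian w x := by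
  have h1 : ∀ x, fderiv ℝ w (t • x) = t • fderiv ℝ w x := fun x => by
    have e := smul_fderiv_of_scaling (pow_ne_zero 2 ht.ne') (hom t ht) x
    rw [sq, mul_smul] at e
    exact smul_right_injective _ ht.ne' e
  have h2 : fderiv ℝ (fderiv ℝ w) (t • x) = fderiv ℝ (fderiv ℝ w) x :=
    smul_right_injective _ ht.ne' (smul_fderiv_of_scaling ht.ne' h1 x)
  rw [hessian, hessian, hessianMatrix, hessianMatrix, h2]

theorem map_zero_of_homogeneous (hom : ∀ t : ℝ, 0 < t → ∀ x, w (t • x) = t ^ 2 * w x) :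
    w 0 = 0 := by
  have := hom 2 two_pos 0
  rw [smul_zero] at this
  linarith

theorem continuous_of_homogeneous (hom : ∀ t : ℝ, 0 < t → ∀ x, w (t • x) = t ^ 2 * w x)
    (hw : ContinuousOn w {0}ᶜ) : Continuous w := by
  rw [continuous_iff_continuousAt]
  intro x
  rcases eq_or_ne x 0 with rfl | hx
  · have hsub : sphere (0 : EuclideanSpace ℝ (Fin n)) 1 ⊆ {0}ᶜ := fun y hy => by
      rintro rfl
      simp at hy
    obtain ⟨C, hC⟩ := (isCompact_sphere _ _).exists_bound_of_continuousOn (hw.mono hsub)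
    have hb : ∀ y, ‖w y‖ ≤ C * ‖y‖ ^ 2 := by
      intro y
      rcases eq_or_ne y 0 with rfl | hy
      · simp [map_zero_of_homogeneous hom]
      · have hn : 0 < ‖y‖ := norm_pos_iff.2 hy
        have h1 := hom ‖y‖ hn (‖y‖⁻¹ • y)
        rw [smul_inv_smul₀ hn.ne'] at h1
        rw [h1, norm_mul, norm_pow, norm_norm, mul_comm]
        refine mul_le_mul_of_nonneg_right (hC _ ?_) (by positivity)
        simp [norm_smul, hn.ne']
    rw [ContinuousAt, map_zero_of_homogeneous hom]
    refine squeeze_zero_norm hb ?_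
    have : Continuous fun y : EuclideanSpace ℝ (Fin n) => C * ‖y‖ ^ 2 := by fun_prop
    simpa using this.tendsto 0
  · exact hw.continuousAt (isOpen_compl_singleton.mem_nhds hx)

/-- `w` need not be twice differentiable at 0, but on each ray it is `t ^ 2 * w z`, valid for `t >
0` only; hence the one-sided tests. The first order test along `y` and `-y` makes the gradient of
`φ` vanish. -/
theorem two_mul_le_of_isLocalMax_zero (hom : ∀ t : ℝ, 0 < t → ∀ x, w (t • x) = t ^ 2 * w x)
    {φ : EuclideanSpace ℝ (Fin n) → ℝ} (hφ : ContDiffAt ℝ 2 φ 0)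
    (hmax : IsLocalMax (fun y => w y - φ y) 0) (y : EuclideanSpace ℝ (Fin n)) :
    2 * w y ≤ fderiv ℝ (fderiv ℝ φ) 0 y y := by
  have hw0 := map_zero_of_homogeneous hom
  have key : ∀ z, ∀ᶠ t : ℝ in 𝓝[>] 0,
      φ (0 + (0 : ℝ) • z) - 0 ^ 2 * w z ≤ φ (0 + t • z) - t ^ 2 * w z := by
    intro z
    have hc : Filter.Tendsto (fun t : ℝ => t • z) (𝓝[>] 0) (𝓝 0) := by
      have : Continuous fun t : ℝ => t • z := by fun_prop
      simpa using (this.tendsto 0).mono_left nhdsWithin_le_nhds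
    filter_upwards [hc.eventually hmax, self_mem_nhdsWithin] with t ht (ht0 : 0 < t)
    rw [hom t ht0, hw0] at ht
    simp only [zero_smul, zero_add]
    linarith
  have hd : ∀ z, ∀ᶠ t : ℝ in 𝓝 0, HasDerivAt (fun t : ℝ => φ (0 + t • z) - t ^ 2 * w z)
      (fderiv ℝ φ (0 + t • z) z - 2 * t * w z) t := by
    intro z
    filter_upwards [(eventually_hasDerivAt_line hφ z).1] with t ht
    exact (ht.sub ((hasDerivAt_pow 2 t).mul_const (w z))).congr_deriv (by simp)
  have hfirst : ∀ z, 0 ≤ fderiv ℝ φ 0 z := by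
    intro z
    simpa using (hd z).self_of_nhds.nonneg_of_eventually_le_right (key z)
  have hzero : fderiv ℝ φ 0 y = 0 :=
    le_antisymm (by simpa using hfirst (-y)) (hfirst y)
  have hd2 : HasDerivAt (fun t : ℝ => fderiv ℝ φ (0 + t • y) y - 2 * t * w y)
      (fderiv ℝ (fderiv ℝ φ) 0 y y - 2 * w y) 0 :=
    ((eventually_hasDerivAt_line hφ y).2.sub
      (((hasDerivAt_id (0 : ℝ)).const_mul 2).mul_const (w y))).congr_deriv (by simp)
  exact sub_nonneg.1 (HasDerivAt.second_nonneg_of_eventually_le_right (hd y) hd2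
    (by simp [hzero]) (key y))

/-- If a `C²` function touches a homogeneous function of order two from above at some point, its
Hessian there dominates the Hessian of the homogeneous function at some point of the sphere. -/
theorem exists_quad_hessian_le_of_isLocalMax [NeZero n]
    (hom : ∀ t : ℝ, 0 < t → ∀ x, w (t • x) = t ^ 2 * w x) (smooth : ContDiffOn ℝ 2 w {0}ᶜ)
    {φ : EuclideanSpace ℝ (Fin n) → ℝ} {x : EuclideanSpace ℝ (Fin n)} (hφ : ContDiffAt ℝ 2 φ x)
    (hmax : IsLocalMax (fun y => w y - φ y) x) :
    ∃ x₀ ∈ sphere (0 : EuclideanSpace ℝ (Fin n)) 1,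
      ∀ ξ, quad ξ (hessian w x₀) ≤ quad ξ (hessian φ x) := by
  have hsm : ∀ y, y ≠ 0 → ContDiffAt ℝ 2 w y := fun y hy =>
    smooth.contDiffAt (isOpen_compl_singleton.mem_nhds hy)
  rcases eq_or_ne x 0 with rfl | hx
  · have hw := continuous_of_homogeneous hom smooth.continuousOn
    set B := fderiv ℝ (fderiv ℝ φ) 0
    obtain ⟨x₀, hx₀, hmin⟩ := (isCompact_sphere (0 : EuclideanSpace ℝ (Fin n)) 1).exists_isMinOn
      (NormedSpace.sphere_nonempty.2 zero_le_one) (f := fun y => B y y - 2 * w y)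
      (by fun_prop)
    set c := B x₀ x₀ - 2 * w x₀
    have hc : 0 ≤ c := sub_nonneg.2 (two_mul_le_of_isLocalMax_zero hom hφ hmax x₀)
    have hn0 : ‖x₀‖ = 1 := mem_sphere_zero_iff_norm.1 hx₀
    have hx0 : x₀ ≠ 0 := by rintro rfl; simp at hn0
    -- Subtracting `c * ‖z‖ ^ 2` turns the minimum over the sphere into a minimum over the whole
    -- space, attained at `x₀` with value 0. The second order test there gives `B - c I ≥ D²w(x₀)`,
    -- and `c ≥ 0` permits dropping `c I`.
    have hall : ∀ z, 0 ≤ B z z - c * inner ℝ z z - 2 * w z := by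
      intro z
      rcases eq_or_ne z 0 with rfl | hz
      · simp [map_zero_of_homogeneous hom]
      · have hn : 0 < ‖z‖ := norm_pos_iff.2 hz
        have h1 : c ≤ B (‖z‖⁻¹ • z) (‖z‖⁻¹ • z) - 2 * w (‖z‖⁻¹ • z) :=
          hmin (by simp [norm_smul, hn.ne'])
        rw [hom _ (inv_pos.2 hn)] at h1
        simp only [map_smul, smul_apply, smul_eq_mul] at h1
        have h2 := mul_le_mul_of_nonneg_right h1 (sq_nonneg ‖z‖)
        have h3 : (‖z‖⁻¹ * (‖z‖⁻¹ * B z z) - 2 * (‖z‖⁻¹ ^ 2 * w z)) * ‖z‖ ^ 2 =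
            B z z - 2 * w z := by field_simp
        rw [real_inner_self_eq_norm_sq]
        linarith
    refine ⟨x₀, hx₀, fun ξ => ?_⟩
    rw [quad_hessian (hsm x₀ hx0), quad_hessian hφ]
    obtain ⟨w1, w2⟩ := eventually_hasDerivAt_line (hsm x₀ hx0) ξ
    have hline : ∀ t : ℝ, HasDerivAt (fun t : ℝ => x₀ + t • ξ) ξ t := fun t => by
      simpa using ((hasDerivAt_id t).smul_const ξ).const_add x₀
    have hB : ∀ t : ℝ, HasDerivAt (fun t : ℝ => B (x₀ + t • ξ)) (B ξ) t := fun t =>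
      B.hasFDerivAt.comp_hasDerivAt t (hline t)
    have hd : ∀ᶠ t : ℝ in 𝓝 0, HasDerivAt
        (fun t : ℝ => B (x₀ + t • ξ) (x₀ + t • ξ) - c * inner ℝ (x₀ + t • ξ) (x₀ + t • ξ) -
          2 * w (x₀ + t • ξ))
        (B ξ (x₀ + t • ξ) + B (x₀ + t • ξ) ξ - c * (2 * inner ℝ (x₀ + t • ξ) ξ) -
          2 * fderiv ℝ w (x₀ + t • ξ) ξ) t := by
      filter_upwards [w1] with t ht
      refine ((((hB t).clm_apply (hline t)).sub
        (((hline t).inner ℝ (hline t)).const_mul c)).sub (ht.const_mul 2)).congr_deriv ?_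
      rw [real_inner_comm (x₀ + t • ξ) ξ]
      ring
    have hd2 : HasDerivAt
        (fun t : ℝ => B ξ (x₀ + t • ξ) + B (x₀ + t • ξ) ξ - c * (2 * inner ℝ (x₀ + t • ξ) ξ) -
          2 * fderiv ℝ w (x₀ + t • ξ) ξ)
        (2 * (B ξ ξ - c * inner ℝ ξ ξ - fderiv ℝ (fderiv ℝ w) x₀ ξ ξ)) 0 := by
      refine (((((B ξ).hasFDerivAt.comp_hasDerivAt 0 (hline 0)).add
        ((hB 0).clm_apply (hasDerivAt_const 0 ξ))).sub
        ((((hline 0).inner ℝ (hasDerivAt_const 0 ξ)).const_mul 2).const_mul c)).sub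
        (w2.const_mul 2)).congr_deriv ?_
      simp
      ring
    have hmin' : IsLocalMin
        (fun t : ℝ => B (x₀ + t • ξ) (x₀ + t • ξ) - c * inner ℝ (x₀ + t • ξ) (x₀ + t • ξ) -
          2 * w (x₀ + t • ξ)) 0 := by
      refine Filter.Eventually.of_forall fun t => ?_
      dsimp only
      refine le_of_eq_of_le ?_ (hall _)
      rw [zero_smul, add_zero, real_inner_self_eq_norm_sq, hn0]
      ring
    have h2 := HasDerivAt.second_nonneg_of_eventually_le_right hd hd2
      (hmin'.hasDerivAt_eq_zero hd.self_of_nhds) (hmin'.filter_mono nhdsWithin_le_nhds)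
    have h3 : 0 ≤ c * inner ℝ ξ ξ := mul_nonneg hc real_inner_self_nonneg
    linarith
  · have hn : 0 < ‖x‖ := norm_pos_iff.2 hx
    refine ⟨‖x‖⁻¹ • x, by simp [norm_smul, hn.ne'], fun ξ => ?_⟩
    rw [hessian_smul_of_homogeneous hom (inv_pos.2 hn)]
    exact quad_hessian_le_of_isLocalMax (hsm x hx) hφ hmax ξ

end Homogeneous

theorem isViscositySolution_of_homogeneous {n : ℕ} [NeZero n] {F : SymMat n → ℝ}
    (hF : IsUniformlyElliptic F) {w : EuclideanSpace ℝ (Fin n) → ℝ}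
    (hom : ∀ t : ℝ, 0 < t → ∀ x, w (t • x) = t ^ 2 * w x) (smooth : ContDiffOn ℝ 2 w {0}ᶜ)
    (hFw : ∀ x ∈ sphere (0 : EuclideanSpace ℝ (Fin n)) 1, F (hessian w x) = 0) :
    IsViscositySolution F univ w where
  continuousOn := (continuous_of_homogeneous hom smooth.continuousOn).continuousOn
  subsolution x _ φ hφ hmax := by
    obtain ⟨x₀, hx₀, h⟩ := exists_quad_hessian_le_of_isLocalMax hom smooth hφ hmax
    rw [← hFw x₀ hx₀]
    exact hF.monotone_quad h
  supersolution x _ φ hφ hmin := by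
    -- `-w` is homogeneous of order two as well, so the case of touching from above applies to it.
    have hmax : IsLocalMax (fun y => -w y - -φ y) x := by
      filter_upwards [hmin] with y hy
      linarith
    obtain ⟨x₀, hx₀, h⟩ := exists_quad_hessian_le_of_isLocalMax (w := fun y => -w y)
      (fun t ht y => by rw [hom t ht]; ring) smooth.neg hφ.neg hmax
    rw [← hFw x₀ hx₀]
    refine hF.monotone_quad fun ξ => ?_
    have := h ξ
    rw [hessian_neg, hessian_neg, map_neg, map_neg] at this
    linarith

/-! ### The sublinear functional given by pinching, and ellipticity. -/

section Pinching

variable {n : ℕ} [NeZero n]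

instance : Nonempty (sphere (0 : EuclideanSpace ℝ (Fin n)) 1) :=
  (NormedSpace.sphere_nonempty.2 zero_le_one).to_subtype

theorem SymMat.abs_maxQuad_le (a : SymMat n) : |maxQuad a| ≤ n ^ 2 * ‖a‖ := by
  have hb : ∀ ξ : sphere (0 : EuclideanSpace ℝ (Fin n)) 1, |quad ξ.1 a| ≤ n ^ 2 * ‖a‖ :=
    fun ξ => abs_quad_le (mem_sphere_zero_iff_norm.1 ξ.2) a
  have ξ₀ := Classical.arbitrary (sphere (0 : EuclideanSpace ℝ (Fin n)) 1)
  exact abs_le.2 ⟨(abs_le.1 (hb ξ₀)).1.trans (le_ciSup (bddAbove_quad a) ξ₀),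
    ciSup_le fun ξ => (abs_le.1 (hb ξ)).2⟩

theorem SymMat.isBoundedSublinear_traceForm_add_maxQuad {K : ℝ} (hK : 0 ≤ K) :
    IsBoundedSublinear fun a : SymMat n => traceForm a + K * maxQuad a where
  map_smul c hc a := by
    have : maxQuad (c • a) = c * maxQuad a := by
      simp only [maxQuad, map_smul, smul_eq_mul]
      exact (Real.mul_iSup_of_nonneg hc.le _).symm
    rw [this, map_smul, smul_eq_mul]
    ring
  map_add_le a b := by
    have : maxQuad (a + b) ≤ maxQuad a + maxQuad b := ciSup_le fun ξ => by
      rw [map_add]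
      exact add_le_add (le_ciSup (bddAbove_quad a) ξ) (le_ciSup (bddAbove_quad b) ξ)
    rw [map_add]
    linarith [mul_le_mul_of_nonneg_left this hK]
  bound := by
    refine ⟨n + K * n ^ 2, by positivity, fun a => (abs_add_le _ _).trans ?_⟩
    rw [abs_mul, abs_of_nonneg hK]
    linarith [abs_traceForm_le a, mul_le_mul_of_nonneg_left (abs_maxQuad_le a) hK]

/-- Pinching says `-μₙ < M μ₁`, so the trace is at least `n μₙ ≥ -n M μ₁`. -/
theorem SymMat.traceForm_add_maxQuad_nonneg {M : ℝ} (hM : 1 ≤ M) {a : SymMat n}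
    (ha : 1 / M < -(a.maxEigenvalue / a.minEigenvalue)) :
    0 ≤ traceForm a + n * M * maxQuad a := by
  have hM0 : 0 < M := by linarith
  have hle : a.minEigenvalue ≤ a.maxEigenvalue :=
    (ciInf_le (Finite.bddBelow_range _) (0 : Fin n)).trans
      (le_ciSup (f := a.isHermitian.eigenvalues) (Finite.bddAbove_range _) 0)
  have hneg : a.maxEigenvalue / a.minEigenvalue < 0 := by
    have : 0 < 1 / M := by positivity
    linarith
  have hmin : a.minEigenvalue < 0 := by
    rcases div_neg_iff.1 hneg with h | h <;> linarith
  rw [← div_neg, div_lt_div_iff₀ hM0 (by linarith)] at ha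
  have h1 : a.maxEigenvalue ≤ maxQuad a := ciSup_le (eigenvalues_le_maxQuad a)
  have h2 := card_mul_minEigenvalue_le a
  have h3 : (0 : ℝ) ≤ n := Nat.cast_nonneg n
  have h4 := mul_le_mul_of_nonneg_right h1 hM0.le
  have h5 := mul_le_mul_of_nonneg_left (show -a.minEigenvalue ≤ maxQuad a * M by linarith) h3
  linarith

/-- At `-ξξᵀ` the `maxQuad` term is at most 0, so the trace leaves `dF(ξξᵀ) ≥ (1 - 1/2)|ξ|²`. At
`ξξᵀ` the bound is `(1 + K + 1/2)|ξ|²`; `2 + K` serves for both. -/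
theorem isUniformlyElliptic_of_fderiv_le {F : SymMat n → ℝ} (hF : Differentiable ℝ F) {K : ℝ}
    (hK : 0 ≤ K) (h : ∀ a v, fderiv ℝ F a v ≤ traceForm v + K * maxQuad v + 1 / 2 * ‖v‖) :
    IsUniformlyElliptic F := by
  refine ⟨hF, 2 + K, by linarith, fun a ξ => ⟨?_, ?_⟩⟩
  · have h1 := h a (-rankOne ξ)
    have h2 : maxQuad (-rankOne ξ) ≤ 0 := ciSup_le fun η => by
      rw [map_neg, quad_rankOne]
      exact neg_nonpos.2 (sq_nonneg _)
    rw [map_neg, map_neg, norm_neg, norm_rankOne, traceForm_rankOne] at h1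
    have h3 := mul_nonpos_of_nonneg_of_nonpos hK h2
    have h4 : (2 + K)⁻¹ * ‖ξ‖ ^ 2 ≤ 2⁻¹ * ‖ξ‖ ^ 2 :=
      mul_le_mul_of_nonneg_right (inv_anti₀ two_pos (by linarith)) (sq_nonneg _)
    linarith
  · have h1 := h a (rankOne ξ)
    have h2 : maxQuad (rankOne ξ) ≤ ‖ξ‖ ^ 2 := ciSup_le fun η => by
      rw [quad_rankOne]
      have h3 : ∑ i, ξ i * η.1 i = inner ℝ η.1 ξ := by simp [PiLp.inner_apply]
      have h4 := abs_real_inner_le_norm η.1 ξ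
      rw [mem_sphere_zero_iff_norm.1 η.2, one_mul] at h4
      rw [h3]
      exact sq_le_sq.2 (by rwa [abs_norm])
    rw [norm_rankOne, traceForm_rankOne] at h1
    have h3 := mul_le_mul_of_nonneg_left h2 hK
    have h4 := sq_nonneg ‖ξ‖
    linarith

end Pinching

/-! ### Assembly of the construction and the viscosity argument. -/

theorem mainTheorem3 {d : ℕ} (w : EuclideanSpace ℝ (Fin (d + 1)) → ℝ)
    (hom : ∀ t : ℝ, 0 < t → ∀ x, w (t • x) = t ^ 2 * w x)
    (smooth : ContDiffOn ℝ ∞ w {0}ᶜ)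
    (hH : PropertyH w) :
    ∃ F : SymMat (d + 1) → ℝ,
      ContDiff ℝ ∞ F ∧ IsUniformlyElliptic F ∧ IsViscositySolution F univ w := by
  obtain ⟨M, hM, hpinch⟩ := hH.pinching
  have hK : 0 ≤ ((d + 1 : ℕ) : ℝ) * M := by positivity
  have hP := isBoundedSublinear_traceForm_add_maxQuad (n := d + 1) hK
  obtain ⟨F, hF, hF0, hFP⟩ := exists_contDiff_fderiv_apply_le hP
    (isCompact_range hH.embedding.isEmbedding.continuous) (range_nonempty _)
    (fun a ha b hb => by
      rcases eq_or_ne a b with rfl | hab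
      · rw [sub_self, hP.map_zero]
      · exact traceForm_add_maxQuad_nonneg hM (hpinch a ha b hb hab).1)
    (fun a ha => hH.embedding.exists_local_retraction ha) (ε := 1 / 2) (by norm_num)
  have hell := isUniformlyElliptic_of_fderiv_le (hF.differentiable (by simp)) hK hFP
  exact ⟨F, hF, hell, isViscositySolution_of_homogeneous hell hom
    (contDiffOn_infty.1 smooth 2) fun x hx => hF0 _ ⟨⟨x, hx⟩, rfl⟩⟩
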